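/- **Syntax.** A vocabulary $\tau$ is a set of propositional atoms. PC-formulas over $\tau$ are built from atoms and the constants $\top,\bot$ by $\neg,\land,\lor$; $F\equiv G$ abbreviates $(F\land G)\lor(\neg F\land\neg G)$. A definition $D$ over $\tau$ is a finite set of rules $P\leftarrow\varphi$ ($P\in\tau$ the head, $\varphi$ a PC-formula), with at most one rule $P\leftarrow\varphi_P$ for each head $P$. The heads form the set $\mathrm{Def}(D)$ of defined atoms; the other atoms of $\tau$ are open in $D$. PC(ID)-formulas are built from atoms, definitions and $\top,\bot$ by $\neg,\land,\lor$. An occurrence of an atom or of a definition in a formula is positive (negative) if it is in the scope of an even (odd) number of negations. **Semantics.** A three-valued interpretation assigns to each atom a value in $\{\mathbf f<\mathbf u<\mathbf t\}$, extended to PC-formulas by $\min$ for $\land$, $\max$ for $\lor$, and for $\neg$ the map that swaps $\mathbf t,\mathbf f$ and fixes $\mathbf u$; it is two-valued if it never takes the value $\mathbf u$. Let $I_O$ be a two-valued interpretation of the open atoms of $D$. A well-founded induction starts with the interpretation that extends $I_O$ and makes all defined atoms $\mathbf u$; each step from $I$ to $J$ is either $J=I[P/\mathbf t]$, where $P$ is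 defined, $I(P)=\mathbf u$ and $\varphi_P^I=\mathbf t$, or $J=I[U/\mathbf f]$, where $U$ is a nonempty set of defined atoms, all unknown in $I$, with $\varphi_P^{J}=\mathbf f$ for all $P\in U$. The last interpretation of a well-founded induction that cannot be extended is the well-founded partial interpretation $I_O^D$. $D$ is total if $I_O^D$ is two-valued for every two-valued $I_O$. A two-valued interpretation $I$ satisfies $D$ if $I=(I|_{\text{open atoms of }D})^D$; satisfaction of other PC(ID)-formulas is then defined as usual. A sequent $\Gamma\to\Delta$ (with $\Gamma,\Delta$ finite sets of PC(ID)-formulas) is valid if every two-valued interpretation that satisfies all formulas of $\Gamma$ satisfies some formula of $\Delta$. **Sequent calculus.** Commas denote union of sets. The initial sequents are $\Gamma,A\to A,\Delta$, $\ \bot\to\Delta$ and $\Gamma\to\top$. The rules are weakening, contraction and cut, Gentzen's left and right rules for $\neg,\land,\lor$, and the following rules, whose conclusions are over a vocabulary $\tau$ and in which $P^{\triangleright},P^{\diamond},P'$ are pairwise distinct new atoms not in $\tau$, so that the premises of the last three are over a larger vocabulary. * Right definition rule, for $P\in\mathrm{Def}(D)$: from $\Gamma\to\Delta,\varphi_P$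 infer $D,\Gamma\to\Delta,P$. * Left definition rule, for $U\subseteq\mathrm{Def}(D)$ and $P\in U$: from $\{\neg R^{\triangleright}: R\in U\},\Gamma\to\Delta,\neg\varphi_Q^{\triangleright}$ for all $Q\in U$ infer $P,D,\Gamma\to\Delta$. Here $\varphi^{\triangleright}$ is $\varphi$ with the positive occurrences of each $R\in U$ replaced by $R^{\triangleright}$. * Non-total definition rule, for $\emptyset\ne V\subseteq\mathrm{Def}(D)$: from $V^{\diamond},D^{\diamond},\Gamma\to\Delta,\bigwedge_{P\in V}\neg P^{\triangleright}$ and $\neg V^{\diamond},D^{\diamond},\Gamma\to\Delta,\bigwedge_{P\in V}P^{\triangleright}$ infer $D,\Gamma\to\Delta$. Here $V^{\diamond}=\{P^{\diamond}:P\in V\}$, $\neg V^{\diamond}=\{\neg P^{\diamond}:P\in V\}$ and $D^{\diamond}=\{P^{\triangleright}\leftarrow\varphi_P^{\diamond}: P\in V\}$, where $\varphi^{\diamond}$ is $\varphi$ with positive occurrences of each $Q\in V$ replaced by $Q^{\triangleright}$ and negative ones by $Q^{\diamond}$. * Definition introduction rule, for a total definition $D$: from $D',\Gamma\to\Delta,P'\equiv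 P$ for all $P\in\mathrm{Def}(D)$ infer $\Gamma\to\Delta,D$. Here $D'$ is $D$ with every occurrence of each defined atom $P$ replaced by $P'$. (For $D=\emptyset$ there are no premises, and $\Gamma\to\Delta,\emptyset$ counts as derived.) A sequent is provable if it is the root of a finite tree of sequents generated by these initial sequents and rules. **Theorem (Completeness).** Let $\Gamma\to\Delta$ be a valid sequent over a vocabulary $\tau$ such that every definition that has a negative occurrence in some formula of $\Gamma$ or a positive occurrence in some formula of $\Delta$ is total. Then $\Gamma\to\Delta$ is provable. -/

import Mathlib

universe u v

namespace PCID

/-! ## Truth values and interpretations -/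

/-- The three truth values false, unknown, true. -/
inductive TruthValue
  | fa
  | un
  | tr

namespace TruthValue

/-- Position in the truth order. -/
def rank : TruthValue → ℕ
  | fa => 0
  | un => 1
  | tr => 2

theorem rank_injective : Function.Injective rank := by
  intro a b h
  cases a <;> cases b <;> simp_all [rank]

/-- The truth order `fa ≤ un ≤ tr`. -/
instance : LinearOrder TruthValue := LinearOrder.lift' rank rank_injective

/-- The inverse of a truth value: it swaps `tr` and `fa` and fixes `un`. -/
def inv : TruthValue → TruthValue
  | fa => tr
  | un => un
  | tr => fa

end TruthValue

/-- A three-valued interpretation of the vocabulary `τ` (a vocabulary is a type of atoms). -/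
abbrev Interp (τ : Type u) := τ → TruthValue

/-- An interpretation is two-valued if no atom is unknown. -/
def TwoValued {τ : Type u} (I : Interp τ) : Prop := ∀ P, I P ≠ TruthValue.un

/-! ## PC-formulas and definitions -/

/-- PC-formulas over `τ`, with the logical constants. -/
inductive PC (τ : Type u) : Type u
  | atom (P : τ)
  | top
  | bot
  | neg (φ : PC τ)
  | and (φ ψ : PC τ)
  | or (φ ψ : PC τ)

namespace PC

/-- Three-valued truth of a PC-formula. -/
def eval {τ : Type u} (I : Interp τ) : PC τ → TruthValue
  | atom P => I P
  | top => TruthValue.tr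
  | bot => TruthValue.fa
  | neg φ => (eval I φ).inv
  | and φ ψ => min (eval I φ) (eval I ψ)
  | or φ ψ => max (eval I φ) (eval I ψ)

/-- Replace every positive occurrence of each atom `P` by `p P` and every negative occurrence by
`n P`; the two renamings are exchanged when a negation is crossed. -/
def rename {τ : Type u} {σ : Type v} (p n : τ → σ) : PC τ → PC σ
  | atom P => atom (p P)
  | top => top
  | bot => bot
  | neg φ => neg (rename n p φ)
  | and φ ψ => and (rename p n φ) (rename p n ψ)
  | or φ ψ => or (rename p n φ) (rename p n ψ)

end PC

/-- A definition over `τ`: a finite set of rules `P ← φ`, written as pairs `(P, φ)`, with at most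
one rule for each head `P`. -/
structure Definition (τ : Type u) : Type u where
  rules : Finset (τ × PC τ)
  unique : ∀ r ∈ rules, ∀ s ∈ rules, r.1 = s.1 → r = s

namespace Definition

variable {τ : Type u} {σ : Type v}

/-- `P` is a defined atom of `D`. All other atoms are open atoms of `D`. -/
def IsDefined (D : Definition τ) (P : τ) : Prop := ∃ φ, (P, φ) ∈ D.rules

/-- Three-valued interpretations of the open atoms of `D`. -/
abbrev OpenInterp (D : Definition τ) := Interp {P : τ // ¬ D.IsDefined P}

/-- The restriction of an interpretation to the open atoms of `D`. -/
def restrictOpen (D : Definition τ) (I : Interp τ) : D.OpenInterp := fun P => I P.1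

open scoped Classical in
/-- The first interpretation of a well-founded induction: it extends `O`, and all defined atoms
are unknown. -/
noncomputable def initial (D : Definition τ) (O : D.OpenInterp) : Interp τ :=
  fun P => if h : D.IsDefined P then TruthValue.un else O ⟨P, h⟩

open scoped Classical in
/-- `I[U/v]`. -/
noncomputable def assign (I : Interp τ) (U : Set τ) (v : TruthValue) : Interp τ :=
  fun P => if P ∈ U then v else I P

/-- First derivation rule: an unknown defined atom becomes true since its body is true. -/
def StepTrue (D : Definition τ) (I J : Interp τ) : Prop :=
  ∃ P φ, (P, φ) ∈ D.rules ∧ I P = TruthValue.un ∧ φ.eval I = TruthValue.tr ∧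
    J = assign I {P} TruthValue.tr

/-- Second derivation rule: a nonempty set `U` of unknown defined atoms becomes false since making
all of them false makes the bodies of all their rules false. -/
def StepFalse (D : Definition τ) (I J : Interp τ) : Prop :=
  ∃ U : Set τ, U.Nonempty ∧ (∀ P ∈ U, D.IsDefined P ∧ I P = TruthValue.un) ∧
    J = assign I U TruthValue.fa ∧
    ∀ P ∈ U, ∀ φ, (P, φ) ∈ D.rules → φ.eval J = TruthValue.fa

/-- One step of a well-founded induction. -/
def Step (D : Definition τ) (I J : Interp τ) : Prop := D.StepTrue I J ∨ D.StepFalse I J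

/-- `J` is the well-founded partial interpretation of `D` extending `O`: the last interpretation
of a well-founded induction that starts from `O` and cannot be extended. (Each step decreases the
finite number of unknown defined atoms, so well-founded inductions are finite sequences.) -/
def IsWellFoundedPartial (D : Definition τ) (O : D.OpenInterp) (J : Interp τ) : Prop :=
  Relation.ReflTransGen D.Step (D.initial O) J ∧ ∀ K, ¬ D.Step J K

/-- `I` is a model of the definition `D`: it is two-valued and it is the well-founded partial
interpretation of `D` that extends its own restriction to the open atoms. -/
def IsTrueIn (D : Definition τ) (I : Interp τ) : Prop :=
  D.IsWellFoundedPartial (D.restrictOpen I) I ∧ TwoValued I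

/-- `D` is total: for every two-valued interpretation of its open atoms, the well-founded partial
interpretation extending it is two-valued. -/
def Total (D : Definition τ) : Prop :=
  ∀ O : D.OpenInterp, TwoValued O → ∃ J, D.IsWellFoundedPartial O J ∧ TwoValued J

open scoped Classical in
/-- The definition `{p P ← φ.rename p n | (P ← φ) ∈ D, P ∈ V}`, for an injective renaming `p` of
heads and positive body occurrences, and a renaming `n` of negative body occurrences. -/
noncomputable def renameOn (D : Definition τ) (V : Set τ) (p : τ ↪ σ) (n : τ → σ) :
    Definition σ where
  rules := (D.rules.filter (fun r => r.1 ∈ V)).image (fun r => (p r.1, r.2.rename p n))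
  unique := by
    intro r hr s hs h
    obtain ⟨a, ha, rfl⟩ := Finset.mem_image.1 hr
    obtain ⟨b, hb, rfl⟩ := Finset.mem_image.1 hs
    rw [D.unique a (Finset.mem_filter.1 ha).1 b (Finset.mem_filter.1 hb).1 (p.injective h)]

/-- Rename all atoms of a definition by an injective map. -/
noncomputable def map (f : τ ↪ σ) (D : Definition τ) : Definition σ :=
  D.renameOn Set.univ f f

end Definition

/-! ## PC(ID)-formulas -/

/-- PC(ID)-formulas over `τ`, with the logical constants. -/
inductive Formula (τ : Type u) : Type u
  | atom (P : τ)
  | defn (D : Definition τ)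
  | top
  | bot
  | neg (F : Formula τ)
  | and (F G : Formula τ)
  | or (F G : Formula τ)

/-- A PC-formula as a PC(ID)-formula. -/
def PC.toFormula {τ : Type u} : PC τ → Formula τ
  | atom P => .atom P
  | top => .top
  | bot => .bot
  | neg φ => .neg φ.toFormula
  | and φ ψ => .and φ.toFormula ψ.toFormula
  | or φ ψ => .or φ.toFormula ψ.toFormula

namespace Formula

noncomputable instance (τ : Type u) : DecidableEq (Formula τ) := Classical.decEq _

open scoped Classical in
/-- The truth function on PC(ID)-formulas; a definition is always true or false. -/
noncomputable def eval {τ : Type u} (I : Interp τ) : Formula τ → TruthValue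
  | atom P => I P
  | defn D => if D.IsTrueIn I then TruthValue.tr else TruthValue.fa
  | top => TruthValue.tr
  | bot => TruthValue.fa
  | neg F => (eval I F).inv
  | and F G => min (eval I F) (eval I G)
  | or F G => max (eval I F) (eval I G)

/-- `I` satisfies `F`, that is, `I` is a model of `F`. -/
def SatisfiedBy {τ : Type u} (F : Formula τ) (I : Interp τ) : Prop :=
  TwoValued I ∧ F.eval I = TruthValue.tr

/-- `Occurs D true F`: the definition `D` has a positive occurrence in `F`, one in the scope of an
even number of negations. `Occurs D false F`: it has a negative occurrence, in the scope of an odd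
number of negations. -/
def Occurs {τ : Type u} (D : Definition τ) : Bool → Formula τ → Prop
  | _, atom _ => False
  | b, defn E => b = true ∧ E = D
  | _, top => False
  | _, bot => False
  | b, neg F => Occurs D (!b) F
  | b, and F G => Occurs D b F ∨ Occurs D b G
  | b, or F G => Occurs D b F ∨ Occurs D b G

/-- Rename all atoms of a formula by an injective map. -/
noncomputable def map {τ : Type u} {σ : Type v} (f : τ ↪ σ) : Formula τ → Formula σ
  | atom P => atom (f P)
  | defn D => defn (D.map f)
  | top => top
  | bot => bot
  | neg F => neg (map f F)
  | and F G => and (map f F) (map f G)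
  | or F G => or (map f F) (map f G)

/-- `F ≡ G`, as an abbreviation. -/
def iff {τ : Type u} (F G : Formula τ) : Formula τ := or (and F G) (and (neg F) (neg G))

/-- The conjunction of a list of formulas, in the given order. -/
def bigAnd {τ : Type u} : List (Formula τ) → Formula τ
  | [] => top
  | [F] => F
  | F :: G :: L => and F (bigAnd (G :: L))

end Formula

/-- A sequent `Γ → Δ` is valid if every model of all formulas of `Γ` satisfies some formula
of `Δ`. -/
def Valid {τ : Type u} (Γ Δ : Finset (Formula τ)) : Prop :=
  ∀ I : Interp τ, TwoValued I → (∀ F ∈ Γ, F.SatisfiedBy I) → ∃ G ∈ Δ, G.SatisfiedBy I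

/-! ## New atoms

The vocabulary `τ` augmented with new atoms, one for each element of a type `X`, is `τ ⊕ X`. -/

/-- A finite set of formulas over `τ`, regarded over the augmented vocabulary `τ ⊕ X`. -/
noncomputable def lift {τ : Type u} (X : Type u) (Γ : Finset (Formula τ)) :
    Finset (Formula (τ ⊕ X)) :=
  Γ.image (Formula.map Function.Embedding.inl)

open scoped Classical in
/-- The renaming that sends every atom `P` of `S` to its new copy `new P` and fixes all other
atoms. -/
noncomputable def renameTo {τ X : Type u} (S : Set τ) (new : S ↪ X) : τ ↪ τ ⊕ X where
  toFun P := if h : P ∈ S then Sum.inr (new ⟨P, h⟩) else Sum.inl P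
  inj' := by
    intro P Q h
    by_cases hP : P ∈ S <;> by_cases hQ : Q ∈ S <;> simp_all

/-- The formula `φ▷` over `τ ⊕ U`: positive occurrences of each atom `P ∈ U` are replaced by its
new copy. -/
noncomputable def PC.triangle {τ : Type u} (U : Set τ) (φ : PC τ) : PC (τ ⊕ U) :=
  φ.rename (renameTo U (Function.Embedding.refl U)) Sum.inl

/-- The definition `D◇ = {P▷ ← φ◇ | P ∈ V, (P ← φ) ∈ D}` over `τ ⊕ (V ⊕ V)`. Here the first copy of
`V` consists of the atoms `P▷` and the second one of the atoms `P◇`, and `φ◇` results from `φ` by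
replacing positive occurrences of each `P ∈ V` by `P▷` and negative ones by `P◇`. -/
noncomputable def Definition.diamond {τ : Type u} (V : Set τ) (D : Definition τ) :
    Definition (τ ⊕ (V ⊕ V)) :=
  D.renameOn V (renameTo V Function.Embedding.inl) (renameTo V Function.Embedding.inr)

/-- The definition `D'` over `τ ⊕ {P | P defined in D}`: every occurrence of each defined atom `P`
of `D` is replaced by its new copy `P'`. -/
noncomputable def Definition.prime {τ : Type u} (D : Definition τ) :
    Definition (τ ⊕ {P : τ | D.IsDefined P}) :=
  D.map (renameTo {P : τ | D.IsDefined P} (Function.Embedding.refl _))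

/-! ## The sequent calculus -/

open Formula in
/-- Provability of sequents `Γ → Δ`, over all vocabularies at once. -/
inductive Provable : {τ : Type u} → Finset (Formula τ) → Finset (Formula τ) → Prop
  -- initial sequents
  | ax {τ : Type u} (Γ Δ : Finset (Formula τ)) (A : Formula τ) :
      Provable (insert A Γ) (insert A Δ)
  | axBot {τ : Type u} (Δ : Finset (Formula τ)) : Provable {bot} Δ
  | axTop {τ : Type u} (Γ : Finset (Formula τ)) : Provable Γ {top}
  -- structural rules
  | weakL {τ : Type u} (Γ Δ : Finset (Formula τ)) (A : Formula τ) :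
      Provable Γ Δ → Provable (insert A Γ) Δ
  | weakR {τ : Type u} (Γ Δ : Finset (Formula τ)) (A : Formula τ) :
      Provable Γ Δ → Provable Γ (insert A Δ)
  | contrL {τ : Type u} (Γ Δ : Finset (Formula τ)) (A : Formula τ) :
      Provable (insert A (insert A Γ)) Δ → Provable (insert A Γ) Δ
  | contrR {τ : Type u} (Γ Δ : Finset (Formula τ)) (A : Formula τ) :
      Provable Γ (insert A (insert A Δ)) → Provable Γ (insert A Δ)
  | cut {τ : Type u} (Γ Δ : Finset (Formula τ)) (A : Formula τ) :
      Provable Γ (insert A Δ) → Provable (insert A Γ) Δ → Provable Γ Δ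
  -- logical rules
  | negL {τ : Type u} (Γ Δ : Finset (Formula τ)) (A : Formula τ) :
      Provable Γ (insert A Δ) → Provable (insert (neg A) Γ) Δ
  | negR {τ : Type u} (Γ Δ : Finset (Formula τ)) (A : Formula τ) :
      Provable (insert A Γ) Δ → Provable Γ (insert (neg A) Δ)
  | andL {τ : Type u} (Γ Δ : Finset (Formula τ)) (A B : Formula τ) :
      Provable (insert A (insert B Γ)) Δ → Provable (insert (and A B) Γ) Δ
  | andR {τ : Type u} (Γ Δ : Finset (Formula τ)) (A B : Formula τ) :
      Provable Γ (insert A Δ) → Provable Γ (insert B Δ) → Provable Γ (insert (and A B) Δ)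
  | orL {τ : Type u} (Γ Δ : Finset (Formula τ)) (A B : Formula τ) :
      Provable (insert A Γ) Δ → Provable (insert B Γ) Δ → Provable (insert (or A B) Γ) Δ
  | orR {τ : Type u} (Γ Δ : Finset (Formula τ)) (A B : Formula τ) :
      Provable Γ (insert A (insert B Δ)) → Provable Γ (insert (or A B) Δ)
  -- right definition rule for `P`
  | defR {τ : Type u} (Γ Δ : Finset (Formula τ)) (D : Definition τ) (P : τ) (φ : PC τ) :
      (P, φ) ∈ D.rules → Provable Γ (insert φ.toFormula Δ) →
      Provable (insert (defn D) Γ) (insert (atom P) Δ)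
  -- left definition rule for `P ∈ U`, with premises `¬U▷, Γ → Δ, ¬φ▷`
  | defL {τ : Type u} (Γ Δ : Finset (Formula τ)) (D : Definition τ) (U : Finset τ) (P : τ) :
      P ∈ U → (∀ Q ∈ U, D.IsDefined Q) →
      (∀ Q φ, Q ∈ U → (Q, φ) ∈ D.rules →
        Provable
          (U.attach.image (fun R => neg (atom (Sum.inr R))) ∪ lift {R // R ∈ (U : Set τ)} Γ)
          (insert (neg (φ.triangle (U : Set τ)).toFormula) (lift {R // R ∈ (U : Set τ)} Δ))) →
      Provable (insert (atom P) (insert (defn D) Γ)) Δ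
  -- non-total definition rule for `D` and the set of the entries of `V`, with premises
  -- `V◇, D◇, Γ → Δ, ⋀ ¬V▷` and `¬V◇, D◇, Γ → Δ, ⋀ V▷`
  | nonTotal {τ : Type u} (Γ Δ : Finset (Formula τ)) (D : Definition τ) (V : List τ) :
      V ≠ [] → V.Nodup → (∀ Q ∈ V, D.IsDefined Q) →
      Provable
        ((V.attach.map (fun R => atom (Sum.inr (Sum.inr R)))).toFinset ∪
          insert (defn (D.diamond {R | R ∈ V})) (lift _ Γ))
        (insert (bigAnd (V.attach.map (fun R => neg (atom (Sum.inr (Sum.inl R))))))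
          (lift _ Δ)) →
      Provable
        ((V.attach.map (fun R => neg (atom (Sum.inr (Sum.inr R))))).toFinset ∪
          insert (defn (D.diamond {R | R ∈ V})) (lift _ Γ))
        (insert (bigAnd (V.attach.map (fun R => atom (Sum.inr (Sum.inl R)))))
          (lift _ Δ)) →
      Provable (insert (defn D) Γ) Δ
  -- definition introduction rule for a total definition `D`, with premises
  -- `D', Γ → Δ, P' ≡ P`
  | defIntro {τ : Type u} (Γ Δ : Finset (Formula τ)) (D : Definition τ) :
      D.Total →
      (∀ P : {P : τ | D.IsDefined P},
        Provable (insert (defn D.prime) (lift _ Γ))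
          (insert (iff (atom (Sum.inr P)) (atom (Sum.inl P.1))) (lift _ Δ))) →
      Provable Γ (insert (defn D) Δ)

end PCID

/-! Cuts on the finitely many atoms of the sequent leave sequents whose literals record a two-valued
interpretation `I`. By validity, `I` falsifies an antecedent formula or satisfies a succedent
formula. The propositional rules (`provable_of_eval`) reduce that formula to its definitions: those
false in `I` must be refuted on the left, those true in `I` derived on the right. The polarity
condition makes the latter total.

To refute `D` (`provable_of_not_isTrueIn`), run a well-founded induction from the open part of `I`.
A step that contradicts `I` closes the sequent by the right or left definition rule. If the
induction stops at some `K` that agrees with `I`, then `K` has unknown atoms, since `K = I` would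
make `D` true; the non-total definition rule is applied to exactly these atoms. With all `P◇` true,
the absence of a true-step makes all `P▷` false; with all `P◇` false, the absence of a false-step
makes all `P▷` true (`provable_of_terminal`).

To derive a total `D` (`provable_of_isTrueIn`), the induction leading to `I` is replayed in `D'`,
cutting in each derived literal, until the atoms `P'` have the values of the atoms `P`. -/

namespace PCID

/-! ### Three-valued connectives and two-valued approximations -/

namespace TruthValue

/-- The lower two-valued approximation, which makes unknown values false. -/
def lower : TruthValue → TruthValue
  | un => fa
  | a => a

/-- The upper two-valued approximation, which makes unknown values true. -/
def upper : TruthValue → TruthValue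
  | un => tr
  | a => a

theorem fa_le (a : TruthValue) : fa ≤ a := Nat.zero_le _

theorem eq_fa_of_le {a : TruthValue} (h : a ≤ fa) : a = fa := le_antisymm h (fa_le a)

theorem inv_le_inv {a b : TruthValue} (h : a ≤ b) : b.inv ≤ a.inv := by
  revert h; cases a <;> cases b <;> decide

theorem inv_eq_tr {a : TruthValue} : a.inv = tr ↔ a = fa := by cases a <;> simp [inv]

theorem inv_eq_fa {a : TruthValue} : a.inv = fa ↔ a = tr := by cases a <;> simp [inv]

theorem min_eq_tr {a b : TruthValue} : min a b = tr ↔ a = tr ∧ b = tr := by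
  cases a <;> cases b <;> decide

theorem min_eq_fa {a b : TruthValue} : min a b = fa ↔ a = fa ∨ b = fa := by
  cases a <;> cases b <;> decide

theorem max_eq_tr {a b : TruthValue} : max a b = tr ↔ a = tr ∨ b = tr := by
  cases a <;> cases b <;> decide

theorem max_eq_fa {a b : TruthValue} : max a b = fa ↔ a = fa ∧ b = fa := by
  cases a <;> cases b <;> decide

theorem lower_inv (a : TruthValue) : a.inv.lower = a.upper.inv := by cases a <;> rfl

theorem upper_inv (a : TruthValue) : a.inv.upper = a.lower.inv := by cases a <;> rfl

theorem lower_min (a b : TruthValue) : (min a b).lower = min a.lower b.lower := by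
  cases a <;> cases b <;> rfl

theorem upper_min (a b : TruthValue) : (min a b).upper = min a.upper b.upper := by
  cases a <;> cases b <;> rfl

theorem lower_max (a b : TruthValue) : (max a b).lower = max a.lower b.lower := by
  cases a <;> cases b <;> rfl

theorem upper_max (a b : TruthValue) : (max a b).upper = max a.upper b.upper := by
  cases a <;> cases b <;> rfl

end TruthValue

/-! ### Separate readings of positive and negative occurrences -/

open TruthValue

variable {τ : Type u} {σ : Type v}

/-- The precision order: `J` agrees with `I` on all atoms that `I` decides. -/
def Precise (I J : Interp τ) : Prop := ∀ P, I P ≠ un → J P = I P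

namespace PC

/-- The value of a formula whose positive atoms are read in `A` and whose negative atoms are read
in `B`. -/
def eval₂ (A B : Interp τ) : PC τ → TruthValue
  | atom P => A P
  | top => tr
  | bot => fa
  | neg φ => (eval₂ B A φ).inv
  | and φ ψ => min (eval₂ A B φ) (eval₂ A B ψ)
  | or φ ψ => max (eval₂ A B φ) (eval₂ A B ψ)

theorem eval₂_self (I : Interp τ) (φ : PC τ) : φ.eval₂ I I = φ.eval I := by
  induction φ <;> simp_all [eval₂, eval]

/-- Crossing a negation exchanges the two renamings together with the two readings. This evaluates
the bodies `φ▷`, `φ◇` and `φ'` in terms of `φ` itself. -/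
theorem eval₂_rename (p n : τ → σ) (A B : Interp σ) (φ : PC τ) :
    (φ.rename p n).eval₂ A B = φ.eval₂ (A ∘ p) (B ∘ n) := by
  induction φ generalizing p n A B <;> simp_all [eval₂, rename]

theorem eval_rename (p n : τ → σ) (I : Interp σ) (φ : PC τ) :
    (φ.rename p n).eval I = φ.eval₂ (I ∘ p) (I ∘ n) := by
  rw [← eval₂_self, eval₂_rename]

theorem eval₂_mono {A A' B B' : Interp τ} (hA : A ≤ A') (hB : B' ≤ B) (φ : PC τ) :
    φ.eval₂ A B ≤ φ.eval₂ A' B' := by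
  induction φ generalizing A A' B B' with
  | atom P => exact hA P
  | top => exact le_rfl
  | bot => exact le_rfl
  | neg φ ih => exact inv_le_inv (ih hB hA)
  | and φ ψ ih ih' => exact min_le_min (ih hA hB) (ih' hA hB)
  | or φ ψ ih ih' => exact max_le_max (ih hA hB) (ih' hA hB)

/-- Both approximations commute with `min` and `max`, and `inv` exchanges them. Thus a three-valued
value splits into two-valued readings, which the atoms `P▷` and `P◇` can express. -/
theorem eval₂_approx (A B : Interp τ) (φ : PC τ) :
    φ.eval₂ (lower ∘ A) (upper ∘ B) = (φ.eval₂ A B).lower ∧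
      φ.eval₂ (upper ∘ A) (lower ∘ B) = (φ.eval₂ A B).upper := by
  induction φ generalizing A B with
  | atom P => exact ⟨rfl, rfl⟩
  | top => exact ⟨rfl, rfl⟩
  | bot => exact ⟨rfl, rfl⟩
  | neg φ ih => simp [eval₂, lower_inv, upper_inv, ih]
  | and φ ψ ih ih' => simp [eval₂, lower_min, upper_min, ih, ih']
  | or φ ψ ih ih' => simp [eval₂, lower_max, upper_max, ih, ih']

/-- The connectives are monotone in precision: a value that is already known survives when unknown
atoms become known. -/
theorem eval_of_precise {I J : Interp τ} (h : Precise I J) (φ : PC τ) :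
    φ.eval I ≠ un → φ.eval J = φ.eval I := by
  induction φ with
  | atom P => exact h P
  | top => exact fun _ => rfl
  | bot => exact fun _ => rfl
  | neg φ ih =>
    simp only [eval]; revert ih
    cases φ.eval I <;> cases φ.eval J <;> decide
  | and φ ψ ih ih' =>
    simp only [eval]; revert ih ih'
    cases φ.eval I <;> cases φ.eval J <;> cases ψ.eval I <;> cases ψ.eval J <;> decide
  | or φ ψ ih ih' =>
    simp only [eval]; revert ih ih'
    cases φ.eval I <;> cases φ.eval J <;> cases ψ.eval I <;> cases ψ.eval J <;> decide

/-- The atoms that occur in a formula. -/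
def atoms : PC τ → Set τ
  | atom P => {P}
  | top => ∅
  | bot => ∅
  | neg φ => φ.atoms
  | and φ ψ => φ.atoms ∪ ψ.atoms
  | or φ ψ => φ.atoms ∪ ψ.atoms

theorem finite_atoms (φ : PC τ) : φ.atoms.Finite := by
  induction φ <;> simp_all [atoms]

theorem exists_of_mem_atoms_rename {p n : τ → σ} {φ : PC τ} {Q : σ}
    (h : Q ∈ (φ.rename p n).atoms) : ∃ P ∈ φ.atoms, Q = p P ∨ Q = n P := by
  induction φ generalizing p n with
  | atom P => exact ⟨P, rfl, Or.inl h⟩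
  | top => exact h.elim
  | bot => exact h.elim
  | neg φ ih => exact (ih h).imp fun P hP => ⟨hP.1, hP.2.symm⟩
  | and φ ψ ih ih' =>
    rcases h with h | h
    · exact (ih h).imp fun P hP => ⟨Or.inl hP.1, hP.2⟩
    · exact (ih' h).imp fun P hP => ⟨Or.inr hP.1, hP.2⟩
  | or φ ψ ih ih' =>
    rcases h with h | h
    · exact (ih h).imp fun P hP => ⟨Or.inl hP.1, hP.2⟩
    · exact (ih' h).imp fun P hP => ⟨Or.inr hP.1, hP.2⟩

end PC

/-! ### Atoms of definitions and formulas -/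

namespace Definition

/-- The atoms that occur in a definition, as heads or in bodies of rules. -/
def atoms (D : Definition τ) : Set τ := ⋃ r ∈ D.rules, insert r.1 r.2.atoms

theorem finite_atoms (D : Definition τ) : D.atoms.Finite :=
  D.rules.finite_toSet.biUnion fun r _ => r.2.finite_atoms.insert r.1

theorem head_mem_atoms {D : Definition τ} {P : τ} {φ : PC τ} (h : (P, φ) ∈ D.rules) :
    P ∈ D.atoms :=
  Set.mem_biUnion (Finset.mem_coe.2 h) (Set.mem_insert _ _)

theorem body_atoms_subset {D : Definition τ} {P : τ} {φ : PC τ} (h : (P, φ) ∈ D.rules) :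
    φ.atoms ⊆ D.atoms := fun _ hQ =>
  Set.mem_biUnion (Finset.mem_coe.2 h) (Set.mem_insert_of_mem _ hQ)

theorem finite_isDefined (D : Definition τ) : {P | D.IsDefined P}.Finite :=
  D.finite_atoms.subset fun _ ⟨_, h⟩ => head_mem_atoms h

theorem mem_rules_renameOn {D : Definition τ} {V : Set τ} {p : τ ↪ σ} {n : τ → σ} {Q : σ}
    {ψ : PC σ} :
    (Q, ψ) ∈ (D.renameOn V p n).rules ↔
      ∃ P φ, (P, φ) ∈ D.rules ∧ P ∈ V ∧ p P = Q ∧ φ.rename p n = ψ := by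
  simp only [renameOn, Finset.mem_image, Finset.mem_filter, Prod.exists, Prod.mk.injEq]
  exact exists_congr fun P => exists_congr fun φ => by tauto

theorem exists_of_mem_atoms_renameOn {D : Definition τ} {V : Set τ} {p : τ ↪ σ} {n : τ → σ} {Q : σ}
    (h : Q ∈ (D.renameOn V p n).atoms) : ∃ P ∈ D.atoms, Q = p P ∨ Q = n P := by
  obtain ⟨⟨R, ψ⟩, hr, hQ⟩ := Set.mem_iUnion₂.1 h
  obtain ⟨P, φ, hP, -, rfl, rfl⟩ := mem_rules_renameOn.1 hr
  rcases hQ with rfl | hQ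
  · exact ⟨P, head_mem_atoms hP, Or.inl rfl⟩
  · obtain ⟨P', hP', h'⟩ := PC.exists_of_mem_atoms_rename hQ
    exact ⟨P', body_atoms_subset hP hP', h'⟩

end Definition

namespace Formula

/-- The atoms that occur in a formula. -/
def atoms : Formula τ → Set τ
  | atom P => {P}
  | defn D => D.atoms
  | top => ∅
  | bot => ∅
  | neg F => F.atoms
  | and F G => F.atoms ∪ G.atoms
  | or F G => F.atoms ∪ G.atoms

theorem finite_atoms (F : Formula τ) : F.atoms.Finite := by
  induction F <;> simp_all [atoms, Definition.finite_atoms]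

/-- Ensures that deciding the atoms of a formula also decides those of its definitions, heads
included. -/
theorem Occurs.atoms_subset {D : Definition τ} {b : Bool} {F : Formula τ} (h : Occurs D b F) :
    D.atoms ⊆ F.atoms := by
  induction F generalizing b with
  | atom P => exact h.elim
  | defn E => rw [← h.2]; exact subset_rfl
  | top => exact h.elim
  | bot => exact h.elim
  | neg F ih => exact ih h
  | and F G ih ih' =>
    exact h.elim (fun h => (ih h).trans Set.subset_union_left)
      fun h => (ih' h).trans Set.subset_union_right
  | or F G ih ih' =>
    exact h.elim (fun h => (ih h).trans Set.subset_union_left)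
      fun h => (ih' h).trans Set.subset_union_right

theorem eval_ne_un {I : Interp τ} (hI : TwoValued I) (F : Formula τ) : F.eval I ≠ un := by
  induction F with
  | atom P => exact hI P
  | defn D => simp only [eval]; split_ifs <;> decide
  | top => simp [eval]
  | bot => simp [eval]
  | neg F ih => simp only [eval]; revert ih; cases F.eval I <;> decide
  | and F G ih ih' =>
    simp only [eval]; revert ih ih'; cases F.eval I <;> cases G.eval I <;> decide
  | or F G ih ih' =>
    simp only [eval]; revert ih ih'; cases F.eval I <;> cases G.eval I <;> decide

end Formula

theorem PC.eval_toFormula (I : Interp τ) (φ : PC τ) : φ.toFormula.eval I = φ.eval I := by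
  induction φ <;> simp_all [PC.toFormula, Formula.eval, PC.eval]

theorem PC.atoms_toFormula (φ : PC τ) : φ.toFormula.atoms = φ.atoms := by
  induction φ <;> simp_all [PC.toFormula, Formula.atoms, PC.atoms]

theorem PC.not_occurs_toFormula (D : Definition τ) (b : Bool) (φ : PC τ) :
    ¬ φ.toFormula.Occurs D b := by
  induction φ generalizing b with
  | atom P => exact id
  | top => exact id
  | bot => exact id
  | neg φ ih => exact ih _
  | and φ ψ ih ih' => exact fun h => h.elim (ih b) (ih' b)
  | or φ ψ ih ih' => exact fun h => h.elim (ih b) (ih' b)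

open Formula

/-! ## Derived rules -/

theorem Provable.weaken {Γ Δ Γ' Δ' : Finset (Formula τ)} (h : Provable Γ Δ) (hΓ : Γ ⊆ Γ')
    (hΔ : Δ ⊆ Δ') : Provable Γ' Δ' := by
  have key : ∀ S T : Finset (Formula τ), Provable (S ∪ Γ) (T ∪ Δ) := by
    intro S T
    induction S using Finset.induction_on with
    | empty =>
      rw [Finset.empty_union]
      induction T using Finset.induction_on with
      | empty => rwa [Finset.empty_union]
      | insert A T _ ih => rw [Finset.insert_union]; exact .weakR _ _ _ ih
    | insert A S _ ih => rw [Finset.insert_union]; exact .weakL _ _ _ ih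
  have := key Γ' Δ'
  rwa [Finset.union_eq_left.2 hΓ, Finset.union_eq_left.2 hΔ] at this

theorem provable_of_mem {Γ Δ : Finset (Formula τ)} {A : Formula τ} (hΓ : A ∈ Γ) (hΔ : A ∈ Δ) :
    Provable Γ Δ := by
  rw [← Finset.insert_eq_of_mem hΓ, ← Finset.insert_eq_of_mem hΔ]
  exact .ax _ _ _

theorem provable_of_neg_mem {Γ Δ : Finset (Formula τ)} {A : Formula τ} (h : neg A ∈ Γ)
    (hA : A ∈ Γ) : Provable Γ Δ := by
  rw [← Finset.insert_eq_of_mem h]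
  exact .negL _ _ _ (provable_of_mem hA (Finset.mem_insert_self _ _))

theorem Provable.cut_left {Γ Δ : Finset (Formula τ)} (T : Finset (Formula τ))
    (hT : ∀ A ∈ T, Provable Γ (insert A Δ)) (h : Provable (T ∪ Γ) Δ) : Provable Γ Δ := by
  induction T using Finset.induction_on with
  | empty => rwa [Finset.empty_union] at h
  | insert A T _ ih =>
    refine ih (fun B hB => hT B (Finset.mem_insert_of_mem hB)) (.cut _ _ A ?_ ?_)
    · exact (hT A (Finset.mem_insert_self _ _)).weaken Finset.subset_union_right subset_rfl
    · rwa [← Finset.insert_union]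

theorem Provable.cut_right {Γ Δ : Finset (Formula τ)} (T : Finset (Formula τ))
    (hT : ∀ A ∈ T, Provable (insert A Γ) Δ) (h : Provable Γ (T ∪ Δ)) : Provable Γ Δ := by
  induction T using Finset.induction_on with
  | empty => rwa [Finset.empty_union] at h
  | insert A T _ ih =>
    refine ih (fun B hB => hT B (Finset.mem_insert_of_mem hB)) (.cut _ _ A ?_ ?_)
    · rwa [← Finset.insert_union]
    · exact (hT A (Finset.mem_insert_self _ _)).weaken subset_rfl Finset.subset_union_right

theorem provable_bigAnd {Γ Δ : Finset (Formula τ)} (L : List (Formula τ))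
    (h : ∀ F ∈ L, Provable Γ (insert F Δ)) : Provable Γ (insert (bigAnd L) Δ) := by
  induction L using bigAnd.induct with
  | case1 => exact (Provable.axTop Γ).weaken subset_rfl (by simp [bigAnd])
  | case2 F => exact h F (by simp)
  | case3 F G L ih =>
    exact .andR _ _ _ _ (h F (by simp)) (ih fun H hH => h H (List.mem_cons_of_mem _ hH))

/-- It suffices to prove a sequent after every decision of finitely many atoms. -/
theorem provable_of_forall_interp (A : Finset τ) (Γ Δ : Finset (Formula τ))
    (h : ∀ I : Interp τ, TwoValued I → ∀ Γ' Δ' : Finset (Formula τ), Γ ⊆ Γ' → Δ ⊆ Δ' →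
      (∀ P ∈ A, I P = tr → atom P ∈ Γ') → (∀ P ∈ A, I P = fa → atom P ∈ Δ') → Provable Γ' Δ') :
    Provable Γ Δ := by
  classical
  induction A using Finset.induction_on generalizing Γ Δ with
  | empty =>
    -- With no atom left to record, any two-valued interpretation serves.
    exact h (fun _ => tr) (fun _ => by simp) Γ Δ subset_rfl subset_rfl (by simp) (by simp)
  | insert Q A hQ ih =>
    have key : ∀ v, v ≠ un → ∀ Γ₁ Δ₁ : Finset (Formula τ), Γ ⊆ Γ₁ → Δ ⊆ Δ₁ →
        (v = tr → atom Q ∈ Γ₁) → (v = fa → atom Q ∈ Δ₁) → Provable Γ₁ Δ₁ := by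
      intro v hv Γ₁ Δ₁ hΓ hΔ ht hf
      refine ih Γ₁ Δ₁ fun I hI Γ' Δ' hΓ' hΔ' hT hF =>
        h (Function.update I Q v) (fun P => ?_) Γ' Δ' (hΓ.trans hΓ') (hΔ.trans hΔ')
          (fun P hP hP' => ?_) (fun P hP hP' => ?_)
      · rcases eq_or_ne P Q with rfl | hne
        · simpa using hv
        · simpa [hne] using hI P
      · rcases eq_or_ne P Q with rfl | hne
        · exact hΓ' (ht (by simpa using hP'))
        · exact hT P (Finset.mem_of_mem_insert_of_ne hP hne) (by simpa [hne] using hP')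
      · rcases eq_or_ne P Q with rfl | hne
        · exact hΔ' (hf (by simpa using hP'))
        · exact hF P (Finset.mem_of_mem_insert_of_ne hP hne) (by simpa [hne] using hP')
    refine .cut _ _ (atom Q) ?_ ?_
    · exact key fa (by decide) _ _ subset_rfl (Finset.subset_insert _ _) (by simp) (by simp)
    · exact key tr (by decide) _ _ (Finset.subset_insert _ _) subset_rfl (by simp) (by simp)

/-! ## Sequents that decide atoms -/

/-- The sequent `Γ → Δ` contains the literal that expresses the value of `P` in `I`, if this value
is known. -/
def Decided (I : Interp τ) (Γ Δ : Finset (Formula τ)) (P : τ) : Prop :=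
  (I P = tr → atom P ∈ Γ) ∧ (I P = fa → atom P ∈ Δ ∨ neg (atom P) ∈ Γ)

namespace Decided

variable {I J : Interp τ} {Γ Δ Γ' Δ' : Finset (Formula τ)} {P : τ}

theorem mono (h : Decided I Γ Δ P) (hΓ : Γ ⊆ Γ') (hΔ : Δ ⊆ Δ') : Decided I Γ' Δ' P :=
  ⟨fun hP => hΓ (h.1 hP), fun hP => (h.2 hP).imp (@hΔ _) (@hΓ _)⟩

/-- A less precise interpretation demands fewer literals, so a sequent that decides `I` also decides
every stage of an induction agreeing with `I`. -/
theorem of_precise (h : Decided J Γ Δ P) (hIJ : Precise I J) : Decided I Γ Δ P :=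
  ⟨fun hP => h.1 ((hIJ P (by simp [hP])).trans hP),
    fun hP => h.2 ((hIJ P (by simp [hP])).trans hP)⟩

theorem of_eq_un (h : I P = un) : Decided I Γ Δ P := by simp [Decided, h]

theorem lift {τ : Type u} {I : Interp τ} {Γ Δ : Finset (Formula τ)} {P : τ} {X : Type u}
    {J : Interp (τ ⊕ X)} (h : Decided I Γ Δ P) (hJ : J (Sum.inl P) = I P) :
    Decided J (lift X Γ) (lift X Δ) (Sum.inl P) := by
  have key : ∀ (F : Formula τ) (S : Finset (Formula τ)), F ∈ S →
      F.map Function.Embedding.inl ∈ PCID.lift X S := fun F S => Finset.mem_image_of_mem _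
  refine ⟨fun hP => key _ _ (h.1 (hJ ▸ hP)), fun hP => ?_⟩
  exact (h.2 (hJ ▸ hP)).imp (key (atom P) _) (key (neg (atom P)) _)

theorem provable_left (h : Decided I Γ Δ P) (hP : I P = fa) :
    Provable (insert (atom P) Γ) Δ := by
  rcases h.2 hP with h | h
  · exact provable_of_mem (Finset.mem_insert_self _ _) h
  · exact provable_of_neg_mem (Finset.mem_insert_of_mem h) (Finset.mem_insert_self _ _)

end Decided

/-- Both sides are treated together because negation exchanges them. The Boolean tracks which
definitions must be derived: positive occurrences for a formula on the right, negative ones for a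
formula on the left. Only there will totality be needed. -/
theorem provable_of_eval {I : Interp τ} {Γ Δ : Finset (Formula τ)} (F : Formula τ)
    (hF : ∀ P ∈ F.atoms, Decided I Γ Δ P) :
    ((∀ D, F.Occurs D true → D.IsTrueIn I → Provable Γ (insert (defn D) Δ)) →
      (∀ D, F.Occurs D false → ¬ D.IsTrueIn I → Provable (insert (defn D) Γ) Δ) →
      F.eval I = tr → Provable Γ (insert F Δ)) ∧
    ((∀ D, F.Occurs D false → D.IsTrueIn I → Provable Γ (insert (defn D) Δ)) →
      (∀ D, F.Occurs D true → ¬ D.IsTrueIn I → Provable (insert (defn D) Γ) Δ) →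
      F.eval I = fa → Provable (insert F Γ) Δ) := by
  induction F with
  | atom P =>
    have hP := hF P rfl
    exact ⟨fun _ _ h => provable_of_mem (hP.1 h) (Finset.mem_insert_self _ _),
      fun _ _ h => hP.provable_left h⟩
  | defn D =>
    refine ⟨fun h _ hD => h D ⟨rfl, rfl⟩ ?_, fun _ h hD => h D ⟨rfl, rfl⟩ fun h' => ?_⟩
    · by_contra h'; simp [eval, h'] at hD
    · simp [eval, h'] at hD
  | top => exact ⟨fun _ _ _ => (Provable.axTop Γ).weaken subset_rfl (by simp),
      fun _ _ h => by simp [eval] at h⟩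
  | bot => exact ⟨fun _ _ h => by simp [eval] at h,
      fun _ _ _ => (Provable.axBot Δ).weaken (by simp) subset_rfl⟩
  | neg F ih =>
    exact ⟨fun h h' he => .negR _ _ _ ((ih hF).2 h h' (inv_eq_tr.1 he)),
      fun h h' he => .negL _ _ _ ((ih hF).1 h h' (inv_eq_fa.1 he))⟩
  | and F G ih ih' =>
    have i := ih fun P hP => hF P (Or.inl hP)
    have i' := ih' fun P hP => hF P (Or.inr hP)
    refine ⟨fun h h' he => ?_, fun h h' he => ?_⟩
    · have he := min_eq_tr.1 he
      exact .andR _ _ _ _ (i.1 (fun D hD => h D (Or.inl hD)) (fun D hD => h' D (Or.inl hD)) he.1)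
        (i'.1 (fun D hD => h D (Or.inr hD)) (fun D hD => h' D (Or.inr hD)) he.2)
    · refine .andL _ _ _ _ ?_
      rcases min_eq_fa.1 he with he | he
      · exact (i.2 (fun D hD => h D (Or.inl hD)) (fun D hD => h' D (Or.inl hD)) he).weaken
          (Finset.insert_subset_insert _ (Finset.subset_insert _ _)) subset_rfl
      · exact (i'.2 (fun D hD => h D (Or.inr hD)) (fun D hD => h' D (Or.inr hD)) he).weaken
          (Finset.subset_insert _ _) subset_rfl
  | or F G ih ih' =>
    have i := ih fun P hP => hF P (Or.inl hP)
    have i' := ih' fun P hP => hF P (Or.inr hP)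
    refine ⟨fun h h' he => ?_, fun h h' he => ?_⟩
    · refine .orR _ _ _ _ ?_
      rcases max_eq_tr.1 he with he | he
      · exact (i.1 (fun D hD => h D (Or.inl hD)) (fun D hD => h' D (Or.inl hD)) he).weaken
          subset_rfl (Finset.insert_subset_insert _ (Finset.subset_insert _ _))
      · exact (i'.1 (fun D hD => h D (Or.inr hD)) (fun D hD => h' D (Or.inr hD)) he).weaken
          subset_rfl (Finset.subset_insert _ _)
    · have he := max_eq_fa.1 he
      exact .orL _ _ _ _ (i.2 (fun D hD => h D (Or.inl hD)) (fun D hD => h' D (Or.inl hD)) he.1)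
        (i'.2 (fun D hD => h D (Or.inr hD)) (fun D hD => h' D (Or.inr hD)) he.2)

/-- Without definitions, the assumptions on occurrences are vacuous. Here `I` may leave atoms
unknown. -/
theorem PC.provable_right {I : Interp τ} {Γ Δ : Finset (Formula τ)} {φ : PC τ}
    (hφ : ∀ P ∈ φ.atoms, Decided I Γ Δ P) (h : φ.eval I = tr) :
    Provable Γ (insert φ.toFormula Δ) :=
  (provable_of_eval φ.toFormula (by rwa [atoms_toFormula])).1
    (fun D hD => (not_occurs_toFormula D _ φ hD).elim)
    (fun D hD => (not_occurs_toFormula D _ φ hD).elim) (by rwa [eval_toFormula])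

theorem PC.provable_left {I : Interp τ} {Γ Δ : Finset (Formula τ)} {φ : PC τ}
    (hφ : ∀ P ∈ φ.atoms, Decided I Γ Δ P) (h : φ.eval I = fa) :
    Provable (insert φ.toFormula Γ) Δ :=
  (provable_of_eval φ.toFormula (by rwa [atoms_toFormula])).2
    (fun D hD => (not_occurs_toFormula D _ φ hD).elim)
    (fun D hD => (not_occurs_toFormula D _ φ hD).elim) (by rwa [eval_toFormula])

/-! ### Renamed atoms and reassigned interpretations -/

open Definition

theorem TruthValue.lower_eq_self {a : TruthValue} (h : a ≠ un) : a.lower = a := by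
  revert h; cases a <;> simp [lower]

theorem TruthValue.upper_eq_self {a : TruthValue} (h : a ≠ un) : a.upper = a := by
  revert h; cases a <;> simp [upper]

theorem renameTo_of_mem {X : Type u} {S : Set τ} (new : S ↪ X) {P : τ} (h : P ∈ S) :
    renameTo S new P = Sum.inr (new ⟨P, h⟩) := dif_pos h

theorem renameTo_of_notMem {X : Type u} {S : Set τ} (new : S ↪ X) {P : τ} (h : P ∉ S) :
    renameTo S new P = Sum.inl P := dif_neg h

theorem assign_of_mem {I : Interp τ} {U : Set τ} {v : TruthValue} {P : τ} (h : P ∈ U) :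
    assign I U v P = v := if_pos h

theorem assign_of_notMem {I : Interp τ} {U : Set τ} {v : TruthValue} {P : τ} (h : P ∉ U) :
    assign I U v P = I P := if_neg h

theorem assign_fa_le (I : Interp τ) (U : Set τ) : assign I U fa ≤ I := fun P => by
  by_cases h : P ∈ U
  · rw [assign_of_mem h]; exact fa_le _
  · rw [assign_of_notMem h]

theorem Precise.assign {I J : Interp τ} (h : Precise I J) (U : Set τ) (v : TruthValue) :
    Precise (assign I U v) (assign J U v) := fun P => by
  by_cases hP : P ∈ U
  · simp [assign_of_mem hP]
  · simpa [assign_of_notMem hP] using h P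

/-! ## The definition rules -/

/-- The right definition rule simulates a true-step, since the decided literals prove the body. -/
theorem provable_of_rule {I : Interp τ} {D : Definition τ} {Γ Δ : Finset (Formula τ)} {P : τ}
    {φ : PC τ} (hI : ∀ P ∈ D.atoms, Decided I Γ Δ P) (hD : defn D ∈ Γ) (hφ : (P, φ) ∈ D.rules)
    (h : φ.eval I = tr) : Provable Γ (insert (atom P) Δ) := by
  have := Provable.defR Γ Δ D P φ hφ
    (PC.provable_right (fun Q hQ => hI Q (body_atoms_subset hφ hQ)) h)
  rwa [Finset.insert_eq_of_mem hD] at this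

/-- The left definition rule simulates a false-step. Since `φ▷` renames positive occurrences only,
`U` is made false there while negative occurrences keep their values in `I`. -/
theorem provable_of_unfounded {I : Interp τ} {D : Definition τ} {Γ Δ : Finset (Formula τ)}
    (U : Finset τ) (hU : ∀ Q ∈ U, D.IsDefined Q) (hI : ∀ P ∈ D.atoms, Decided I Γ Δ P)
    (hD : defn D ∈ Γ)
    (h : ∀ Q ∈ U, ∀ φ, (Q, φ) ∈ D.rules → φ.eval₂ (assign I U fa) I = fa) {P : τ} (hP : P ∈ U) :
    Provable (insert (atom P) Γ) Δ := by
  rw [← Finset.insert_eq_of_mem hD]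
  refine .defL Γ Δ D U P hP hU fun Q φ hQ hφ => .negR _ _ _
    (PC.provable_left (I := Sum.elim I fun _ => fa) (fun R hR => ?_) ?_)
  · obtain ⟨S, hS, hR⟩ := PC.exists_of_mem_atoms_rename hR
    have hSI := ((hI S (body_atoms_subset hφ hS)).lift (X := {R // R ∈ (U : Set τ)})
      (J := Sum.elim I fun _ => fa) rfl)
    by_cases hSU : S ∈ (U : Set τ)
    · rw [renameTo_of_mem _ hSU] at hR
      rcases hR with rfl | rfl
      · refine ⟨fun h => ?_, fun _ => Or.inr (Finset.mem_union_left _ ?_)⟩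
        · simp at h
        · exact Finset.mem_image_of_mem _ (Finset.mem_attach _ _)
      · exact hSI.mono Finset.subset_union_right subset_rfl
    · rw [renameTo_of_notMem _ hSU, or_self] at hR
      rw [hR]
      exact hSI.mono Finset.subset_union_right subset_rfl
  · rw [PC.triangle, PC.eval_rename]
    refine Eq.trans ?_ (h Q hQ φ hφ)
    congr 1
    funext R
    by_cases hR : R ∈ (U : Set τ)
    · simp [renameTo_of_mem _ hR, assign_of_mem hR]
    · simp [renameTo_of_notMem _ hR, assign_of_notMem hR]

/-- The values of the new atoms `P▷` and `P◇` are given by `A` and `B`. -/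
def diamondInterp (V : Set τ) (I A B : Interp τ) : Interp (τ ⊕ (V ⊕ V)) :=
  Sum.elim I (Sum.elim (fun P => A P) fun P => B P)

theorem decided_diamond {I A B : Interp τ} {D : Definition τ} {Γ Δ : Finset (Formula τ)}
    {V : Set τ} (hI : ∀ P ∈ D.atoms, Decided I Γ Δ P) {Γ' Δ' : Finset (Formula (τ ⊕ (V ⊕ V)))}
    (hΓ : lift _ Γ ⊆ Γ') (hΔ : lift _ Δ ⊆ Δ')
    (hA : ∀ P : V, Decided (diamondInterp V I A B) Γ' Δ' (Sum.inr (Sum.inl P)))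
    (hB : ∀ P : V, Decided (diamondInterp V I A B) Γ' Δ' (Sum.inr (Sum.inr P))) :
    ∀ P ∈ (D.diamond V).atoms, Decided (diamondInterp V I A B) Γ' Δ' P := by
  intro Q hQ
  obtain ⟨P, hP, hQ⟩ := exists_of_mem_atoms_renameOn hQ
  by_cases hPV : P ∈ V
  · rw [renameTo_of_mem _ hPV, renameTo_of_mem _ hPV] at hQ
    rcases hQ with rfl | rfl
    exacts [hA _, hB _]
  · rw [renameTo_of_notMem _ hPV, renameTo_of_notMem _ hPV, or_self] at hQ
    rw [hQ]
    exact ((hI P hP).lift rfl).mono hΓ hΔ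

theorem diamondInterp_comp_inl {V : Set τ} {I A B : Interp τ} (hA : ∀ P ∉ V, A P = I P) :
    diamondInterp V I A B ∘ renameTo V Function.Embedding.inl = A := by
  funext P
  by_cases hP : P ∈ V
  · simp [renameTo_of_mem _ hP, diamondInterp]
  · simp [renameTo_of_notMem _ hP, diamondInterp, hA P hP]

theorem diamondInterp_comp_inr {V : Set τ} {I A B : Interp τ} (hB : ∀ P ∉ V, B P = I P) :
    diamondInterp V I A B ∘ renameTo V Function.Embedding.inr = B := by
  funext P
  by_cases hP : P ∈ V
  · simp [renameTo_of_mem _ hP, diamondInterp]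
  · simp [renameTo_of_notMem _ hP, diamondInterp, hB P hP]

/-- If the atoms `P◇` are true, then `D◇` makes the atoms `P▷` false, provided that `D` allows to
derive none of the unknown atoms as true. -/
theorem provable_triangle_left {I K : Interp τ} {D : Definition τ} {Γ Δ : Finset (Formula τ)}
    {V : Set τ} (hI : ∀ P ∈ D.atoms, Decided I Γ Δ P) (hKI : Precise K I)
    (hV : ∀ P, P ∈ V ↔ K P = un) (hK : ∀ P ∈ V, D.IsDefined P)
    (hstep : ∀ J, ¬ D.StepTrue K J) {Γ' Δ' : Finset (Formula (τ ⊕ (V ⊕ V)))}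
    (hΓ : lift _ Γ ⊆ Γ') (hΔ : lift _ Δ ⊆ Δ') (hD : defn (D.diamond V) ∈ Γ')
    (hlit : ∀ R : V, atom (Sum.inr (Sum.inr R)) ∈ Γ') (P : V) :
    Provable (insert (atom (Sum.inr (Sum.inl P))) Γ') Δ' := by
  have hKV : ∀ P ∉ V, K P ≠ un := fun P hP h => hP ((hV P).2 h)
  have hA : ∀ P ∉ V, (lower ∘ K) P = I P := fun P hP => by
    rw [hKI P (hKV P hP)]
    exact lower_eq_self (hKV P hP)
  have hB : ∀ P ∉ V, (upper ∘ K) P = I P := fun P hP => by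
    rw [hKI P (hKV P hP)]
    exact upper_eq_self (hKV P hP)
  have hfin : Finite V := D.finite_isDefined.subset hK
  let U : Finset (τ ⊕ (V ⊕ V)) :=
    (Set.finite_range fun R : V => (Sum.inr (Sum.inl R) : τ ⊕ (V ⊕ V))).toFinset
  have hU : ∀ Q, Q ∈ U ↔ ∃ R : V, Sum.inr (Sum.inl R) = Q := fun Q => by simp [U]
  -- The atoms `P▷` begin unknown, as the sequent does not decide them. Making them false turns the
  -- positive reading into the lower approximation of `K`.
  have hassign : assign (diamondInterp V I (fun _ => un) (upper ∘ K)) U fa =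
      diamondInterp V I (lower ∘ K) (upper ∘ K) := by
    funext Q
    by_cases hQ : Q ∈ (U : Set _)
    · rw [assign_of_mem hQ]
      obtain ⟨R, rfl⟩ := (hU Q).1 hQ
      simp [diamondInterp, (hV R).1 R.2, lower]
    · rw [assign_of_notMem hQ]
      rcases Q with Q | Q | Q
      · rfl
      · exact (hQ ((hU _).2 ⟨Q, rfl⟩)).elim
      · rfl
  refine provable_of_unfounded (I := diamondInterp V I (fun _ => un) (upper ∘ K)) U
    (fun Q hQ => ?_) (decided_diamond hI hΓ hΔ (fun P => .of_eq_un rfl) fun R => ?_) hD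
    (fun Q hQ ψ hψ => ?_) ((hU _).2 ⟨P, rfl⟩)
  · obtain ⟨R, rfl⟩ := (hU Q).1 hQ
    obtain ⟨φ, hφ⟩ := hK R R.2
    exact ⟨_, mem_rules_renameOn.2 ⟨R, φ, hφ, R.2, renameTo_of_mem _ R.2, rfl⟩⟩
  · refine ⟨fun _ => hlit R, fun h => ?_⟩
    simp [diamondInterp, (hV R).1 R.2, upper] at h
  · obtain ⟨R, φ, hφ, hR, -, rfl⟩ := mem_rules_renameOn.1 hψ
    -- A true body would permit a true-step; otherwise its lower approximation is false.
    have he : φ.eval K ≠ tr := fun he => hstep _ ⟨R, φ, hφ, (hV R).1 hR, he, rfl⟩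
    rw [hassign, PC.eval₂_rename, diamondInterp_comp_inl hA, diamondInterp_comp_inr hB,
      (PC.eval₂_approx K K φ).1, PC.eval₂_self]
    revert he
    cases φ.eval K <;> simp [lower]

/-- If the atoms `P◇` are false, then `D◇` makes the atoms `P▷` true, provided that `D` allows to
derive none of the unknown atoms as false. -/
theorem provable_triangle_right {I K : Interp τ} {D : Definition τ} {Γ Δ : Finset (Formula τ)}
    {V : Set τ} (hI : ∀ P ∈ D.atoms, Decided I Γ Δ P) (hKI : Precise K I)
    (hV : ∀ P, P ∈ V ↔ K P = un) (hK : ∀ P ∈ V, D.IsDefined P)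
    (hstep : ∀ J, ¬ D.StepFalse K J) {Γ' Δ' : Finset (Formula (τ ⊕ (V ⊕ V)))}
    (hΓ : lift _ Γ ⊆ Γ') (hΔ : lift _ Δ ⊆ Δ') (hD : defn (D.diamond V) ∈ Γ')
    (hlit : ∀ R : V, neg (atom (Sum.inr (Sum.inr R))) ∈ Γ') (P : V) :
    Provable Γ' (insert (atom (Sum.inr (Sum.inl P))) Δ') := by
  have hKV : ∀ P ∉ V, K P ≠ un := fun P hP h => hP ((hV P).2 h)
  have hfin : Finite V := D.finite_isDefined.subset hK
  -- The atoms whose copy `Q▷` is not provable. If there are any, they do not form a false-step, so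
  -- one of their bodies is not falsified; that body will prove its own head.
  let U : Set τ := {Q | ∃ h : Q ∈ V, ¬ Provable Γ' (insert (atom (Sum.inr (Sum.inl ⟨Q, h⟩))) Δ')}
  by_contra hP
  have hUV : ∀ Q ∈ U, Q ∈ V := fun Q hQ => hQ.1
  obtain ⟨Q, hQ, φ, hφ, he⟩ : ∃ Q ∈ U, ∃ φ, (Q, φ) ∈ D.rules ∧
      φ.eval (assign K U fa) ≠ fa := by
    by_contra hcon
    push Not at hcon
    exact hstep _ ⟨U, ⟨P, P.2, hP⟩,
      fun Q hQ => ⟨hK Q (hUV Q hQ), (hV Q).1 (hUV Q hQ)⟩, rfl, hcon⟩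
  have hJ : ∀ P ∉ V, assign K U fa P = I P := fun P hP => by
    rw [assign_of_notMem fun h => hP (hUV P h), hKI P (hKV P hP)]
  have hJun : ∀ P ∉ V, assign K U fa P ≠ un := fun P hP => by
    rw [hJ P hP, hKI P (hKV P hP)]; exact hKV P hP
  have hA : ∀ P ∉ V, assign (upper ∘ assign K U fa) U un P = I P := fun P hP => by
    rw [assign_of_notMem fun h => hP (hUV P h), ← hJ P hP]
    exact upper_eq_self (hJun P hP)
  have hB : ∀ P ∉ V, (lower ∘ assign K U fa) P = I P := fun P hP => by
    rw [← hJ P hP]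
    exact lower_eq_self (hJun P hP)
  -- The copies of atoms of `U` are not decided, hence unknown rather than false; this only raises
  -- positive occurrences.
  have hAle : upper ∘ assign K U fa ≤ assign (upper ∘ assign K U fa) U un := fun P => by
    by_cases hP : P ∈ U
    · simp only [Function.comp, assign_of_mem hP]; exact fa_le _
    · rw [assign_of_notMem hP]
  -- The provable atoms `R▷`, which may be cut into the antecedent.
  let T : Finset (Formula (τ ⊕ (V ⊕ V))) := (Set.toFinite
    ((fun R : V => (atom (Sum.inr (Sum.inl R)) : Formula (τ ⊕ (V ⊕ V)))) '' {R | R.1 ∉ U})).toFinset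
  have hT : ∀ F, F ∈ T ↔ ∃ R : V, R.1 ∉ U ∧ atom (Sum.inr (Sum.inl R)) = F := fun F => by
    rw [Set.Finite.mem_toFinset]; exact Iff.rfl
  refine hQ.2 (.cut_left T (fun F hF => ?_)
    (provable_of_rule (I := diamondInterp V I
        (assign (upper ∘ assign K U fa) U un) (lower ∘ assign K U fa))
      (decided_diamond hI (hΓ.trans Finset.subset_union_right) hΔ (fun R => ?_) fun R => ?_)
      (Finset.mem_union_right _ hD)
      (mem_rules_renameOn.2 ⟨Q, φ, hφ, hUV Q hQ, renameTo_of_mem _ (hUV Q hQ), rfl⟩) ?_))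
  · obtain ⟨R, hR, rfl⟩ := (hT F).1 hF
    have hR : Provable Γ' (insert (atom (Sum.inr (Sum.inl R))) Δ') := by
      by_contra h; exact hR ⟨R.2, h⟩
    exact hR.weaken subset_rfl (Finset.insert_subset_insert _ (Finset.subset_insert _ _))
  · by_cases hR : R.1 ∈ U
    · exact .of_eq_un (assign_of_mem hR)
    · refine ⟨fun _ => Finset.mem_union_left _ ((hT _).2 ⟨R, hR, rfl⟩), fun h => ?_⟩
      simp [diamondInterp, assign_of_notMem hR, (hV R).1 R.2, upper] at h
  · refine ⟨fun h => ?_, fun _ => Or.inr (Finset.mem_union_right _ (hlit R))⟩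
    by_cases hR : R.1 ∈ U
    · simp [diamondInterp, assign_of_mem hR, lower] at h
    · simp [diamondInterp, assign_of_notMem hR, (hV R).1 R.2, lower] at h
  · rw [PC.eval_rename, diamondInterp_comp_inl hA, diamondInterp_comp_inr hB]
    have h1 := PC.eval₂_mono hAle (le_refl (lower ∘ assign K U fa)) φ
    rw [(PC.eval₂_approx _ _ φ).2, PC.eval₂_self] at h1
    revert h1 he
    cases φ.eval (assign K U fa) <;> cases φ.eval₂ _ _ <;> decide

/-- The non-total definition rule refutes a definition whose well-founded partial interpretation
`K` is not two-valued. -/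
theorem provable_of_terminal {I K : Interp τ} {D : Definition τ} {Γ Δ : Finset (Formula τ)}
    (hI : ∀ P ∈ D.atoms, Decided I Γ Δ P) (hD : defn D ∈ Γ) (hKI : Precise K I)
    (hK : ∀ P, K P = un → D.IsDefined P) (hun : ∃ P, K P = un) (hstep : ∀ J, ¬ D.Step K J) :
    Provable Γ Δ := by
  obtain ⟨V, hnd, hV⟩ : ∃ V : List τ, V.Nodup ∧ ∀ P, P ∈ V ↔ K P = un := by
    have hfin : {P | K P = un}.Finite := D.finite_isDefined.subset hK
    exact ⟨hfin.toFinset.toList, Finset.nodup_toList _, fun P => by simp⟩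
  have hVD : ∀ P ∈ V, D.IsDefined P := fun P hP => hK P ((hV P).1 hP)
  have hne : V ≠ [] := by
    obtain ⟨P, hP⟩ := hun
    exact List.ne_nil_of_mem ((hV P).2 hP)
  rw [← Finset.insert_eq_of_mem hD]
  refine .nonTotal Γ Δ D V hne hnd hVD (provable_bigAnd _ fun F hF => ?_)
    (provable_bigAnd _ fun F hF => ?_)
  · obtain ⟨P, -, rfl⟩ := List.mem_map.1 hF
    exact .negR _ _ _ (provable_triangle_left (V := {R | R ∈ V}) hI hKI hV hVD
      (fun J h => hstep J (Or.inl h))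
      ((Finset.subset_insert _ _).trans Finset.subset_union_right) subset_rfl
      (Finset.mem_union_right _ (Finset.mem_insert_self _ _))
      (fun R => Finset.mem_union_left _ (List.mem_toFinset.2
        (List.mem_map.2 ⟨R, List.mem_attach _ _, rfl⟩))) P)
  · obtain ⟨P, -, rfl⟩ := List.mem_map.1 hF
    exact provable_triangle_right (V := {R | R ∈ V}) hI hKI hV hVD
      (fun J h => hstep J (Or.inr h))
      ((Finset.subset_insert _ _).trans Finset.subset_union_right) subset_rfl
      (Finset.mem_union_right _ (Finset.mem_insert_self _ _))
      (fun R => Finset.mem_union_left _ (List.mem_toFinset.2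
        (List.mem_map.2 ⟨R, List.mem_attach _ _, rfl⟩))) P

/-- A sequent that decides the atoms of a definition in a two-valued interpretation refutes the
definition if it is false there. -/
theorem provable_of_not_isTrueIn {I : Interp τ} (hTV : TwoValued I) {D : Definition τ}
    {Γ Δ : Finset (Formula τ)} (hI : ∀ P ∈ D.atoms, Decided I Γ Δ P) (hD : defn D ∈ Γ)
    (hn : ¬ D.IsTrueIn I) : Provable Γ Δ := by
  -- `K` is a stage of an induction that has agreed with `I` so far; each further step lowers the
  -- number of unknown atoms.
  suffices key : ∀ (n : ℕ) (K : Interp τ), {P | K P = un}.ncard = n → Precise K I →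
      (∀ P, K P = un → D.IsDefined P) →
      Relation.ReflTransGen D.Step (D.initial (D.restrictOpen I)) K → Provable Γ Δ by
    refine key _ (D.initial (D.restrictOpen I)) rfl (fun P hP => ?_) (fun P hP => ?_) .refl
    · by_cases h : D.IsDefined P
      · simp [initial, h] at hP
      · simp [initial, h, restrictOpen]
    · by_contra h
      simp [initial, h, restrictOpen, hTV P] at hP
  intro n
  induction n using Nat.strong_induction_on with
  | _ n ih =>
  intro K hn' hKI hK hreach
  have hfin : {P | K P = un}.Finite := D.finite_isDefined.subset hK
  have hdecr : ∀ (U : Set τ) (v : TruthValue), v ≠ un → U.Nonempty → (∀ P ∈ U, K P = un) →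
      (∀ P ∈ U, I P = v) → D.Step K (assign K U v) → Provable Γ Δ := by
    intro U v hv ⟨Q, hQ⟩ hU hIU hs
    have hsub : ∀ P, assign K U v P = un → P ∉ U ∧ K P = un := fun P hP => by
      by_cases hPU : P ∈ U
      · exact (hv (by rwa [assign_of_mem hPU] at hP)).elim
      · exact ⟨hPU, by rwa [assign_of_notMem hPU] at hP⟩
    refine ih _ ?_ (assign K U v) rfl (fun P hP => ?_) (fun P hP => hK P (hsub P hP).2)
      (hreach.tail hs)
    · rw [← hn']
      exact Set.ncard_lt_ncard ⟨fun P hP => (hsub P hP).2,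
        fun h => (hsub Q (h (hU Q hQ))).1 hQ⟩ hfin
    · by_cases hPU : P ∈ U
      · rw [assign_of_mem hPU, hIU P hPU]
      · rw [assign_of_notMem hPU] at hP ⊢; exact hKI P hP
  by_cases hstep : ∃ J, D.Step K J
  · obtain ⟨J, hs⟩ := hstep
    rcases id hs with ⟨P, φ, hφ, hP, he, rfl⟩ | ⟨U, hU, hUK, rfl, he⟩
    · by_cases hIP : I P = tr
      · exact hdecr {P} tr (by decide) ⟨P, rfl⟩ (by simpa using hP) (by simpa using hIP) hs
      · have hIP : I P = fa := by
          have := hTV P; revert this hIP; cases I P <;> simp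
        -- The step makes true an atom that the sequent records as false.
        exact .cut _ _ _ (provable_of_rule (fun Q hQ => (hI Q hQ).of_precise hKI) hD hφ he)
          ((hI P (head_mem_atoms hφ)).provable_left hIP)
    · by_cases hIU : ∀ P ∈ U, I P = fa
      · exact hdecr U fa (by decide) hU (fun P hP => (hUK P hP).2) hIU hs
      · obtain ⟨P, hP, hIP⟩ : ∃ P ∈ U, I P ≠ fa := by push Not at hIU; exact hIU
        have hIP : I P = tr := by
          have := hTV P; revert this hIP; cases I P <;> simp
        have hUfin : U.Finite := D.finite_isDefined.subset fun P hP => (hUK P hP).1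
        obtain ⟨φ, hφ⟩ := (hUK P hP).1
        -- Here `P` is true in `I` and belongs to a set that the step makes false.
        rw [← Finset.insert_eq_of_mem ((hI P (head_mem_atoms hφ)).1 hIP)]
        refine provable_of_unfounded hUfin.toFinset
          (fun Q hQ => (hUK Q (hUfin.mem_toFinset.1 hQ)).1) hI hD (fun Q hQ ψ hψ => ?_)
          (hUfin.mem_toFinset.2 hP)
        rw [hUfin.coe_toFinset]
        have h1 := he Q (hUfin.mem_toFinset.1 hQ) ψ hψ
        have h2 := PC.eval_of_precise (hKI.assign U fa) ψ (by rw [h1]; decide)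
        rw [h1, ← PC.eval₂_self] at h2
        -- Restoring `I` at negative occurrences of `U` can only lower the value.
        exact eq_fa_of_le ((PC.eval₂_mono le_rfl (assign_fa_le I U) ψ).trans h2.le)
  · push Not at hstep
    refine provable_of_terminal hI hD hKI hK ?_ hstep
    by_contra hun
    push Not at hun
    have : I = K := funext fun P => hKI P (hun P)
    subst this
    exact hn ⟨⟨hreach, hstep⟩, hTV⟩

/-- A sequent that decides the atoms of a total definition in one of its models proves the
definition. -/
theorem provable_of_isTrueIn {I : Interp τ} {D : Definition τ} (hT : D.Total)
    {Γ Δ : Finset (Formula τ)} (hI : ∀ P ∈ D.atoms, Decided I Γ Δ P)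
    (h : D.IsTrueIn I) : Provable Γ (insert (defn D) Δ) := by
  refine .defIntro Γ Δ D hT fun P => ?_
  -- The new atoms are decided up to stage `K`. Steps are removed from the front, since the sequent
  -- grows along the induction.
  suffices key : ∀ K : Interp τ, Relation.ReflTransGen D.Step K I →
      (∀ Q, ¬ D.IsDefined Q → K Q = I Q) → ∀ Γ' Δ', lift _ Γ ⊆ Γ' → lift _ Δ ⊆ Δ' →
      defn D.prime ∈ Γ' → Formula.iff (atom (Sum.inr P)) (atom (Sum.inl P.1)) ∈ Δ' →
      (∀ Q : {P | D.IsDefined P},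
        Decided (Sum.elim I fun R : {P | D.IsDefined P} => K R) Γ' Δ' (Sum.inr Q)) → Provable Γ' Δ' by
    refine key (D.initial (D.restrictOpen I)) h.1.1 (fun Q hQ => ?_) _ _ (Finset.subset_insert _ _)
      (Finset.subset_insert _ _) (Finset.mem_insert_self _ _) (Finset.mem_insert_self _ _)
      fun Q => .of_eq_un ?_
    · simp [initial, hQ, restrictOpen]
    · have : D.IsDefined Q.1 := Q.2
      simp [initial, this]
  intro K hK
  induction hK using Relation.ReflTransGen.head_induction_on with
  | refl =>
    intro _ Γ' Δ' hΓ hΔ _ hiff hQ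
    rw [← Finset.insert_eq_of_mem hiff]
    have hP : P.1 ∈ D.atoms := by
      obtain ⟨φ, hφ⟩ := P.2
      exact head_mem_atoms hφ
    -- At the end, both sides of the equivalence have the same known value in `I`.
    refine PC.provable_right (I := Sum.elim I fun R : {P | D.IsDefined P} => I R)
      (φ := .or (.and (.atom (Sum.inr P)) (.atom (Sum.inl P.1)))
        (.and (.neg (.atom (Sum.inr P))) (.neg (.atom (Sum.inl P.1))))) (fun R hR => ?_) ?_
    · have hR : R = Sum.inr P ∨ R = Sum.inl P.1 := by
        simp only [PC.atoms] at hR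
        simpa [or_comm] using hR
      rcases hR with rfl | rfl
      · exact hQ P
      · exact ((hI _ hP).lift rfl).mono hΓ hΔ
    · have := h.2 P
      simp only [PC.eval, Sum.elim_inl, Sum.elim_inr]
      revert this
      cases I P.1 <;> decide
  | @head K J hs _ ih =>
    intro hopen Γ' Δ' hΓ hΔ hD hiff hQ
    let S : Set τ := {P | D.IsDefined P}
    let f := renameTo S (Function.Embedding.refl S)
    have hf : ∀ Q (h : D.IsDefined Q), f Q = Sum.inr ⟨Q, h⟩ := fun Q h =>
      renameTo_of_mem _ (show Q ∈ S from h)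
    have hcomp : (Sum.elim I fun R : S => K R) ∘ f = K := by
      funext Q
      by_cases hQ : D.IsDefined Q
      · simp [hf Q hQ]
      · simp [f, renameTo_of_notMem _ (show Q ∉ S from hQ), hopen Q hQ]
    have hdec : ∀ Q ∈ D.prime.atoms, Decided (Sum.elim I fun R : S => K R) Γ' Δ' Q := by
      intro Q hQ'
      obtain ⟨R, hR, hQ'⟩ := exists_of_mem_atoms_renameOn hQ'
      rw [or_self] at hQ'
      by_cases hRS : R ∈ S
      · rw [hQ', renameTo_of_mem _ hRS]; exact hQ _
      · rw [hQ', renameTo_of_notMem _ hRS]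
        exact ((hI R hR).lift rfl).mono hΓ hΔ
    rcases hs with ⟨R, φ, hφ, hR, he, rfl⟩ | ⟨U, -, hU, rfl, he⟩
    · have hRD : D.IsDefined R := ⟨φ, hφ⟩
      -- A true-step adds its new atom to the antecedent.
      refine .cut _ _ (atom (Sum.inr (⟨R, hRD⟩ : S))) ?_ (ih (fun Q hQ => ?_) _ _
        (hΓ.trans (Finset.subset_insert _ _)) hΔ (Finset.mem_insert_of_mem hD) hiff fun Q => ?_)
      · refine provable_of_rule hdec hD (φ := φ.rename f f)
          (mem_rules_renameOn.2 ⟨R, φ, hφ, trivial, hf R hRD, rfl⟩) ?_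
        rw [PC.eval_rename, hcomp, PC.eval₂_self, he]
      · rw [assign_of_notMem, hopen Q hQ]
        rintro rfl
        exact hQ hRD
      · by_cases hQR : Q.1 = R
        · subst hQR
          refine ⟨fun _ => Finset.mem_insert_self _ _, fun h => ?_⟩
          simp [assign_of_mem] at h
        · have := (hQ Q).mono (Finset.subset_insert (atom (Sum.inr (⟨R, hRD⟩ : S))) _) subset_rfl
          simpa [Decided, assign_of_notMem (show Q.1 ∉ ({R} : Set τ) from hQR)] using this
    · have hfin : U.Finite := D.finite_isDefined.subset fun Q hQ => (hU Q hQ).1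
      let U' : Finset (τ ⊕ S) := hfin.toFinset.map f
      have hU' : ∀ Q (h : D.IsDefined Q), Sum.inr ⟨Q, h⟩ ∈ U' ↔ Q ∈ U := fun Q h => by
        rw [← hf Q h]; simp [U']
      have hassign : assign (Sum.elim I fun R : S => K R) U' fa ∘ f = assign K U fa := by
        funext Q
        by_cases hQ : Q ∈ U
        · rw [assign_of_mem hQ]
          exact assign_of_mem (by simpa [U'] using hQ)
        · rw [assign_of_notMem hQ, ← congrFun hcomp Q]
          exact assign_of_notMem (by simpa [U'] using hQ)
      -- A false-step adds the copies of all atoms of `U` to the succedent.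
      refine .cut_right (U'.image atom) (fun F hF => ?_) (ih (fun Q hQ => ?_) _ _ hΓ
        (hΔ.trans Finset.subset_union_right) hD (Finset.mem_union_right _ hiff) fun Q => ?_)
      · obtain ⟨Q, hQ, rfl⟩ := Finset.mem_image.1 hF
        refine provable_of_unfounded U' (fun R hR => ?_) hdec hD (fun R hR ψ hψ => ?_) hQ
        · obtain ⟨R, hRU, rfl⟩ := Finset.mem_map.1 hR
          obtain ⟨φ, hφ⟩ := (hU R (hfin.mem_toFinset.1 hRU)).1
          exact ⟨_, mem_rules_renameOn.2 ⟨R, φ, hφ, trivial, rfl, rfl⟩⟩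
        · obtain ⟨R, φ, hφ, -, rfl, rfl⟩ := mem_rules_renameOn.1 hψ
          have hR : R ∈ U := hfin.mem_toFinset.1 ((Finset.mem_map' f).1 hR)
          have he := he R hR φ hφ
          rw [← PC.eval₂_self] at he
          rw [PC.eval₂_rename]
          change φ.eval₂ (_ ∘ f) (_ ∘ f) = fa
          rw [hassign, hcomp]
          exact eq_fa_of_le ((PC.eval₂_mono le_rfl (assign_fa_le K U) φ).trans he.le)
      · rw [assign_of_notMem fun h => hQ (hU Q h).1, hopen Q hQ]
      · by_cases hQU : Q.1 ∈ U
        · refine ⟨fun h => ?_, fun _ => Or.inl (Finset.mem_union_left _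
            (Finset.mem_image_of_mem _ ((hU' Q.1 Q.2).2 hQU)))⟩
          simp [assign_of_mem hQU] at h
        · have := (hQ Q).mono subset_rfl (Finset.subset_union_right (s₁ := U'.image atom))
          simpa [Decided, assign_of_notMem hQU] using this

end PCID

/-! ### Completeness -/

theorem mainTheorem1 {τ : Type*} (Γ Δ : Finset (PCID.Formula τ))
    (hvalid : PCID.Valid Γ Δ)
    (hΓ : ∀ F ∈ Γ, ∀ D : PCID.Definition τ, F.Occurs D false → D.Total)
    (hΔ : ∀ F ∈ Δ, ∀ D : PCID.Definition τ, F.Occurs D true → D.Total) :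
    PCID.Provable Γ Δ := by
  have hfin : (⋃ F ∈ Γ ∪ Δ, F.atoms).Finite :=
    (Γ ∪ Δ).finite_toSet.biUnion fun F _ => F.finite_atoms
  refine PCID.provable_of_forall_interp hfin.toFinset Γ Δ fun I hI Γ' Δ' hΓ' hΔ' ht hf => ?_
  have hdec : ∀ F ∈ Γ ∪ Δ, ∀ P ∈ F.atoms, PCID.Decided I Γ' Δ' P := fun F hF P hP =>
    have hP : P ∈ hfin.toFinset := hfin.mem_toFinset.2 (Set.mem_biUnion (Finset.mem_coe.2 hF) hP)
    ⟨ht P hP, fun h => Or.inl (hf P hP h)⟩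
  -- Refutation needs no totality, so it covers both polarities.
  have hleft : ∀ F ∈ Γ ∪ Δ, ∀ b, ∀ D : PCID.Definition τ, F.Occurs D b → ¬ D.IsTrueIn I →
      PCID.Provable (insert (.defn D) Γ') Δ' := fun F hF b D hD hn =>
    PCID.provable_of_not_isTrueIn hI
      (fun P hP => (hdec F hF P (hD.atoms_subset hP)).mono (Finset.subset_insert _ _) subset_rfl)
      (Finset.mem_insert_self _ _) hn
  by_cases h : ∀ F ∈ Γ, F.SatisfiedBy I
  · obtain ⟨G, hG, -, hGI⟩ := hvalid I hI h
    have hG' := Finset.mem_union_right Γ hG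
    rw [← Finset.insert_eq_of_mem (hΔ' hG)]
    exact (PCID.provable_of_eval G (hdec G hG')).1
      (fun D hD => PCID.provable_of_isTrueIn (hΔ G hG D hD)
        fun P hP => hdec G hG' P (hD.atoms_subset hP)) (hleft G hG' _) hGI
  · push Not at h
    obtain ⟨F, hF, hFI⟩ := h
    have hF' := Finset.mem_union_left Δ hF
    have hFI : F.eval I = .fa := by
      have h1 := F.eval_ne_un hI
      have h2 : F.eval I ≠ .tr := fun h => hFI ⟨hI, h⟩
      revert h1 h2
      cases F.eval I <;> simp
    rw [← Finset.insert_eq_of_mem (hΓ' hF)]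
    exact (PCID.provable_of_eval F (hdec F hF')).2
      (fun D hD => PCID.provable_of_isTrueIn (hΓ F hF D hD)
        fun P hP => hdec F hF' P (hD.atoms_subset hP)) (hleft F hF' _) hFI
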